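/- Let $\mathcal{E}$ be a complex Hilbert space (of finite or infinite dimension), let $\|\cdot\|$ be the operator norm, and let $H_1,H_2$ be bounded self-adjoint operators on $\mathcal{E}$ with $\|H_2\|\le\|H_1\|$. Define Suzuki's splitting operators by $$S_2(s)=e^{-iH_1s/2}\,e^{-iH_2s}\,e^{-iH_1s/2},\qquad S_{2k}(s)=[S_{2k-2}(p_ks)]^2\,S_{2k-2}((1-4p_k)s)\,[S_{2k-2}(p_ks)]^2,\quad p_k=\bigl(4-4^{1/(2k-1)}\bigr)^{-1},$$ for $s\in\mathbb{R}$ and $k=2,3,\dots$. **Theorem 1.** Let $t$ and $\varepsilon$ be real numbers with $1\ge\varepsilon>0$ and $8et\|H_2\|\ge\varepsilon$ (so that $t>0$). Then for every integer $k\ge1$ the evolution $e^{-i(H_1+H_2)t}$ can be simulated with accuracy $\varepsilon$ by applying $S_{2k}$ on equal subintervals, with a number $N$ of exponentials that is bounded by $$N\le 3\cdot5^{k-1}\left\lceil \|H_1\|\,t\left(\frac{8et\|H_2\|}{\varepsilon}\right)^{1/(2k)}\frac{8e}{3}\left(\frac53\right)^{k-1}\right\rceil .$$ That is, there are an integer $n\ge1$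 and a product $P=\prod_{l=1}^{N}e^{-iA_lt_l}$ of $N$ exponentials, with $A_l\in\{H_1,H_2\}$, $t_l\in\mathbb{R}$ and $N$ bounded as above, such that $P=S_{2k}(t/n)^n$ and $\|e^{-i(H_1+H_2)t}-P\|\le\varepsilon$. -/

import Mathlib

/-- The unitary `e^{-i H s}` generated by the bounded operator `H` for the time `s`. -/
noncomputable def evol {E : Type*} [NormedAddCommGroup E] [InnerProductSpace ℂ E]
    (H : E →L[ℂ] E) (s : ℝ) : E →L[ℂ] E :=
  NormedSpace.exp ((-(Complex.I * (s : ℂ))) • H)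

/-- Suzuki's coefficient `p_k = (4 - 4^{1/(2k-1)})⁻¹`, used for `k ≥ 2`. -/
noncomputable def suzukiP (k : ℕ) : ℝ :=
  (4 - (4 : ℝ) ^ (1 / (2 * (k : ℝ) - 1)))⁻¹

/-- Suzuki's splitting operator `S_{2k}(H₁, H₂, s)`. The case `k = 1` is the Strang splitting;
the value at `k = 0` is a dummy, which is never used in the recursion. -/
noncomputable def suzukiS {E : Type*} [NormedAddCommGroup E] [InnerProductSpace ℂ E]
    (H₁ H₂ : E →L[ℂ] E) : ℕ → ℝ → (E →L[ℂ] E)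
  | 0, _ => 1
  | 1, s => evol H₁ (s / 2) * evol H₂ s * evol H₁ (s / 2)
  | k + 2, s =>
      suzukiS H₁ H₂ (k + 1) (suzukiP (k + 2) * s) ^ 2
        * suzukiS H₁ H₂ (k + 1) ((1 - 4 * suzukiP (k + 2)) * s)
        * suzukiS H₁ H₂ (k + 1) (suzukiP (k + 2) * s) ^ 2

/-- The ordered product `∏ e^{-i A_l t_l}` described by a list of pairs `(A_l, t_l)`, where
`A_l = H₁` if the first entry is `false` and `A_l = H₂` if it is `true`.
The number of exponentials in it is the length of the list. -/
noncomputable def expProduct {E : Type*} [NormedAddCommGroup E] [InnerProductSpace ℂ E]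
    (H₁ H₂ : E →L[ℂ] E) (L : List (Bool × ℝ)) : E →L[ℂ] E :=
  (L.map fun p => evol (if p.1 then H₂ else H₁) p.2).prod

/-! Time is made complex. With `X = -iH₁` and `Y = -iH₂`, the splitting and `exp (z • (X + Y))` are
entire in `z`, and their difference is `z ^ (2k+1) • G z` with `G` entire (`complexSuzuki_agrees`):
the equation for `p_k` kills one odd order, and the symmetry `S(z) S(-z) = 1` kills the next, even
one. On a circle `‖z‖ = R` both maps are compared with `exp (z • X)`, the case `Y = 0`. This makes
the difference small with `‖Y‖` (`complexSuzuki_majorizedBy`, `norm_exp_add_sub_exp_le`), and the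
maximum principle for `G` carries the bound inside with the factor `(‖z‖ / R) ^ (2k+1)`. The radius
`k / (c ‖X‖)`, where `c = suzukiTime k ≤ k (5/3)^(k-1)`, gives the local error
`norm_complexSuzuki_sub_exp_le_pow`. At real times everything is unitary, so `n` steps at most
multiply this error by `n`. -/

/-! ### Order of accuracy and Suzuki's recursion -/

section Order

variable {A : Type*} [NormedRing A] [NormedAlgebra ℂ A]

/-- `F z = E (a z) + z ^ m G(z)` with `G` entire and `G 0 = g`. -/
def AgreesToOrder (E : ℂ → A) (m : ℕ) (F : ℂ → A) (a : ℂ) (g : A) : Prop :=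
  ∃ G : ℂ → A, Differentiable ℂ G ∧ G 0 = g ∧ ∀ z, F z = E (a * z) + z ^ m • G z

namespace AgreesToOrder

variable {E F F₁ F₂ : ℂ → A} {m : ℕ} {a b : ℂ} {g g₁ g₂ : A}

theorem mul (hE : Differentiable ℂ E) (hE0 : E 0 = 1) (hadd : ∀ x y, E x * E y = E (x + y))
    (hm : m ≠ 0) (h₁ : AgreesToOrder E m F₁ a g₁) (h₂ : AgreesToOrder E m F₂ b g₂) :
    AgreesToOrder E m (fun z => F₁ z * F₂ z) (a + b) (g₁ + g₂) := by
  obtain ⟨G₁, hd₁, h0₁, hF₁⟩ := h₁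
  obtain ⟨G₂, hd₂, h0₂, hF₂⟩ := h₂
  refine ⟨fun z => G₁ z * E (b * z) + E (a * z) * G₂ z + z ^ m • (G₁ z * G₂ z), ?_, ?_, ?_⟩
  · fun_prop
  · simp [hE0, h0₁, h0₂, hm]
  · intro z
    have h := hadd (a * z) (b * z)
    simp only [hF₁, hF₂, add_mul, mul_add, smul_mul_assoc, mul_smul_comm, smul_add, ← h]
    abel

theorem rescale (h : AgreesToOrder E m F a g) (c : ℂ) :
    AgreesToOrder E m (fun z => F (c * z)) (a * c) (c ^ m • g) := by
  obtain ⟨G, hd, h0, hF⟩ := h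
  refine ⟨fun z => c ^ m • G (c * z), by fun_prop, by simp [h0], fun z => ?_⟩
  simp only [hF, mul_pow, smul_smul, mul_assoc]
  rw [mul_comm (z ^ m)]

theorem succ [CompleteSpace A] (h : AgreesToOrder E m F a 0) :
    ∃ g, AgreesToOrder E (m + 1) F a g := by
  obtain ⟨G, hd, h0, hF⟩ := h
  refine ⟨dslope G 0 0, dslope G 0, ?_, rfl, fun z => ?_⟩
  · rw [← differentiableOn_univ] at hd ⊢
    exact (Complex.differentiableOn_dslope Filter.univ_mem).2 hd
  · have h := sub_smul_dslope G 0 z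
    rw [sub_zero, h0, sub_zero] at h
    rw [hF, pow_succ, mul_smul, h]

/-- In `F z * F (-z)` the leading errors add up to `g + (-1) ^ m • g = 2g`, but the product is
exactly `1`. The quotient by `z ^ m` is known only off `0`; continuity gives its value there. -/
theorem eq_zero_of_symmetric (hE : Differentiable ℂ E) (hE0 : E 0 = 1)
    (hadd : ∀ x y, E x * E y = E (x + y)) (hm : Even m) (hm0 : m ≠ 0)
    (hF : ∀ z, F z * F (-z) = 1) (h : AgreesToOrder E m F a g) : g = 0 := by
  have h' := h.mul hE hE0 hadd hm0 (h.rescale (-1))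
  obtain ⟨K, hd, h0, hK⟩ := h'
  have hz : ∀ z : ℂ, z ≠ 0 → K z = 0 := by
    intro z hz
    have h1 := hK z
    simp only [neg_mul, one_mul, hF, mul_neg, mul_one, add_neg_cancel, zero_mul, hE0] at h1
    have h2 : z ^ m • K z = 0 := by simpa using h1.symm
    exact (smul_eq_zero.1 h2).resolve_left (pow_ne_zero _ hz)
  have hK0 : K = fun _ => 0 := by
    refine Continuous.ext_on (s := {0}ᶜ) (dense_compl_singleton 0) hd.continuous
      continuous_const fun z hz' => hz z hz'
  have h3 : g + g = 0 := by
    have := h0.symm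
    rw [hK0, hm.neg_one_pow, one_smul] at this
    exact this
  have h4 : (2 : ℂ) • g = 0 := by rw [two_smul, h3]
  exact (smul_eq_zero.1 h4).resolve_left two_ne_zero

/-- Suzuki's step raises an odd order of accuracy of a symmetric splitting by two. -/
theorem suzuki_step [CompleteSpace A] (hE : Differentiable ℂ E) (hE0 : E 0 = 1)
    (hadd : ∀ x y, E x * E y = E (x + y)) {p : ℂ} (hm : Odd m)
    (hp : 4 * p ^ m + (1 - 4 * p) ^ m = 0) (hF : ∀ z, F z * F (-z) = 1)
    (h : AgreesToOrder E m F 1 g) :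
    ∃ g', AgreesToOrder E (m + 2)
      (fun z => F (p * z) ^ 2 * F ((1 - 4 * p) * z) * F (p * z) ^ 2) 1 g' := by
  have hm0 : m ≠ 0 := by rintro rfl; simp at hm
  have h1 := (h.rescale p).mul hE hE0 hadd hm0 (h.rescale p)
  have h2 := (h1.mul hE hE0 hadd hm0 (h.rescale (1 - 4 * p))).mul hE hE0 hadd hm0 h1
  have ha : 1 * p + 1 * p + 1 * (1 - 4 * p) + (1 * p + 1 * p) = 1 := by ring
  have hg : p ^ m • g + p ^ m • g + (1 - 4 * p) ^ m • g + (p ^ m • g + p ^ m • g) = 0 := by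
    have : (4 * p ^ m + (1 - 4 * p) ^ m) • g = 0 := by rw [hp, zero_smul]
    rw [← this]
    module
  rw [ha, hg] at h2
  obtain ⟨g₁, h3⟩ := h2.succ
  have hsym : ∀ z, (F (p * z) * F (p * z) * F ((1 - 4 * p) * z) * (F (p * z) * F (p * z))) *
      (F (p * -z) * F (p * -z) * F ((1 - 4 * p) * -z) * (F (p * -z) * F (p * -z))) = 1 := by
    intro z
    have e : ∀ w u, F w * (F (-w) * u) = u := fun w u => by rw [← mul_assoc, hF, one_mul]
    simp only [mul_neg, mul_assoc, e, hF]
  -- The root condition has raised the order to the even number `m + 1`, so symmetry gives one more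
  -- order for free.
  have h4 := h3.eq_zero_of_symmetric hE hE0 hadd hm.add_one (by omega) hsym
  rw [h4] at h3
  simpa only [sq] using h3.succ

end AgreesToOrder

end Order

/-! ### Size of Suzuki's coefficients -/

section Coefficients

theorem one_lt_four_rpow {k : ℕ} (hk : 2 ≤ k) : 1 < (4 : ℝ) ^ (1 / (2 * (k : ℝ) - 1)) := by
  have hk' : (2 : ℝ) ≤ k := by exact_mod_cast hk
  exact Real.one_lt_rpow (by norm_num) (by apply one_div_pos.2; linarith)

theorem four_rpow_pow {k : ℕ} (hk : 2 ≤ k) :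
    ((4 : ℝ) ^ (1 / (2 * (k : ℝ) - 1))) ^ (2 * k - 1) = 4 := by
  have hk' : (2 : ℝ) ≤ k := by exact_mod_cast hk
  rw [← Real.rpow_natCast, ← Real.rpow_mul (by norm_num)]
  have : ((2 * k - 1 : ℕ) : ℝ) = 2 * (k : ℝ) - 1 := by
    rw [Nat.cast_sub (by omega)]; push_cast; ring
  rw [this, one_div, inv_mul_cancel₀ (by linarith), Real.rpow_one]

/-- Bernoulli's inequality: `(1 + 3/(2k-1)) ^ (2k-1) ≥ 1 + 3`. -/
theorem four_rpow_le {k : ℕ} (hk : 2 ≤ k) :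
    (4 : ℝ) ^ (1 / (2 * (k : ℝ) - 1)) ≤ 1 + 3 / (2 * k - 1) := by
  have hk' : (2 : ℝ) ≤ k := by exact_mod_cast hk
  have hpos : (0 : ℝ) < 2 * k - 1 := by linarith
  have h3 : (0 : ℝ) ≤ 3 / (2 * k - 1) := by positivity
  refine le_of_pow_le_pow_left₀ (n := 2 * k - 1) (by omega) (by linarith) ?_
  rw [four_rpow_pow hk]
  have h := one_add_mul_le_pow (a := (3 / (2 * k - 1) : ℝ)) (by linarith) (2 * k - 1)
  have hc : ((2 * k - 1 : ℕ) : ℝ) = 2 * (k : ℝ) - 1 := by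
    rw [Nat.cast_sub (by omega)]; push_cast; ring
  rw [hc, mul_div_cancel₀ _ hpos.ne'] at h
  linarith

theorem four_rpow_le_two {k : ℕ} (hk : 2 ≤ k) :
    (4 : ℝ) ^ (1 / (2 * (k : ℝ) - 1)) ≤ 2 := by
  have hk' : (2 : ℝ) ≤ k := by exact_mod_cast hk
  have h : (3 : ℝ) / (2 * k - 1) ≤ 1 := by rw [div_le_one (by linarith)]; linarith
  linarith [four_rpow_le hk]

theorem third_lt_suzukiP {k : ℕ} (hk : 2 ≤ k) : 1 / 3 < suzukiP k := by
  have h1 := one_lt_four_rpow hk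
  have h2 := four_rpow_le_two hk
  rw [suzukiP, one_div, inv_lt_inv₀ (by norm_num) (by linarith)]
  linarith

theorem suzukiP_root {k : ℕ} (hk : 2 ≤ k) :
    4 * suzukiP k ^ (2 * k - 1) + (1 - 4 * suzukiP k) ^ (2 * k - 1) = 0 := by
  have h2 := four_rpow_le_two hk
  have h4 := four_rpow_pow hk
  have hodd : Odd (2 * k - 1) := ⟨k - 1, by omega⟩
  have e : 1 - 4 * suzukiP k = -((4 : ℝ) ^ (1 / (2 * (k : ℝ) - 1)) * suzukiP k) := by
    rw [suzukiP]
    generalize (4 : ℝ) ^ (1 / (2 * (k : ℝ) - 1)) = x at h2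
    have : 4 - x ≠ 0 := by linarith
    field_simp
    ring
  rw [e, hodd.neg_pow, mul_pow, h4]
  ring

/-- The limit of `8 p_k - 1` is `5/3`, as `p_k → 1/3`; the correction `k / (k - 1)` is chosen to
telescope in `suzukiTime_le`. -/
theorem suzukiP_le {k : ℕ} (hk : 2 ≤ k) :
    8 * suzukiP k - 1 ≤ 5 / 3 * (k / ((k : ℝ) - 1)) := by
  have hk' : (2 : ℝ) ≤ k := by exact_mod_cast hk
  have h := four_rpow_le hk
  have h0 : (0 : ℝ) < 2 * k - 1 := by linarith
  have h1 : (0 : ℝ) < 4 - (1 + 3 / (2 * k - 1)) := by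
    have : (3 : ℝ) / (2 * k - 1) ≤ 1 := by rw [div_le_one (by linarith)]; linarith
    linarith
  have h2 : suzukiP k ≤ (4 - (1 + 3 / (2 * (k : ℝ) - 1)))⁻¹ := by
    rw [suzukiP]
    exact inv_anti₀ h1 (by linarith)
  have h3 : (4 - (1 + 3 / (2 * (k : ℝ) - 1)))⁻¹ = (2 * k - 1) / (6 * (k - 1)) := by
    have : (k : ℝ) - 1 ≠ 0 := by linarith
    have e : 4 - (1 + 3 / (2 * (k : ℝ) - 1)) = 6 * (k - 1) / (2 * k - 1) := by
      field_simp; ring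
    rw [e, inv_div]
  rw [h3] at h2
  have hk1 : (0 : ℝ) < k - 1 := by linarith
  have h4 : 5 / 3 * (k / ((k : ℝ) - 1)) - (8 * ((2 * k - 1) / (6 * (k - 1))) - 1)
      = (1 / 3) / (k - 1) := by field_simp; ring
  have h5 : (0 : ℝ) ≤ (1 / 3) / (k - 1) := by positivity
  linarith

/-- The total time `∑ |t_l|` that each `H_j` acts for in `S_{2k}(1)`. -/
noncomputable def suzukiTime : ℕ → ℝ
  | 0 => 1
  | 1 => 1
  | k + 2 => suzukiTime (k + 1) * (8 * suzukiP (k + 2) - 1)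

theorem one_le_suzukiTime (k : ℕ) : 1 ≤ suzukiTime (k + 1) := by
  induction k with
  | zero => simp [suzukiTime]
  | succ k ih =>
    have h := third_lt_suzukiP (k := k + 2) (by omega)
    rw [suzukiTime]
    exact one_le_mul_of_one_le_of_one_le ih (by linarith)

theorem suzukiTime_le (k : ℕ) : suzukiTime (k + 1) ≤ (k + 1) * (5 / 3) ^ k := by
  induction k with
  | zero => simp [suzukiTime]
  | succ k ih =>
    have h := third_lt_suzukiP (k := k + 2) (by omega)
    have h' := suzukiP_le (k := k + 2) (by omega)
    rw [suzukiTime]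
    calc _ ≤ ((k + 1) * (5 / 3) ^ k) * (5 / 3 * ((k + 2 : ℕ) / (((k + 2 : ℕ) : ℝ) - 1))) :=
          mul_le_mul ih h' (by linarith) (by positivity)
      _ = _ := by
        push_cast
        have : (k : ℝ) + 2 - 1 = k + 1 := by ring
        rw [this]
        field_simp
        ring

end Coefficients

/-! ### Differences of powers -/

section PowerDifferences

variable {A : Type*} [NormedRing A] [NormOneClass A]

theorem norm_add_pow_sub_pow_le (x y : A) (n : ℕ) :
    ‖(x + y) ^ n - x ^ n‖ ≤ (‖x‖ + ‖y‖) ^ n - ‖x‖ ^ n := by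
  induction n with
  | zero => simp
  | succ n ih =>
    have e : (x + y) ^ (n + 1) - x ^ (n + 1) = ((x + y) ^ n - x ^ n) * (x + y) + x ^ n * y := by
      rw [pow_succ, pow_succ]; noncomm_ring
    rw [e]
    calc _ ≤ ‖(x + y) ^ n - x ^ n‖ * ‖x + y‖ + ‖x ^ n‖ * ‖y‖ :=
          (norm_add_le _ _).trans (add_le_add (norm_mul_le _ _) (norm_mul_le _ _))
      _ ≤ ((‖x‖ + ‖y‖) ^ n - ‖x‖ ^ n) * (‖x‖ + ‖y‖) + ‖x‖ ^ n * ‖y‖ := by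
        gcongr
        · exact (norm_nonneg _).trans ih
        · exact norm_add_le _ _
        · exact norm_pow_le x n
      _ = _ := by ring

theorem norm_pow_sub_pow_le_mul {u v : A} (hu : ‖u‖ ≤ 1) (hv : ‖v‖ ≤ 1) (n : ℕ) :
    ‖u ^ n - v ^ n‖ ≤ n * ‖u - v‖ := by
  induction n with
  | zero => simp
  | succ n ih =>
    have e : u ^ (n + 1) - v ^ (n + 1) = (u ^ n - v ^ n) * u + v ^ n * (u - v) := by
      rw [pow_succ, pow_succ]; noncomm_ring
    have hvn : ‖v ^ n‖ ≤ 1 := (norm_pow_le v n).trans (pow_le_one₀ (norm_nonneg _) hv)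
    rw [e]
    calc _ ≤ ‖u ^ n - v ^ n‖ * ‖u‖ + ‖v ^ n‖ * ‖u - v‖ :=
          (norm_add_le _ _).trans (add_le_add (norm_mul_le _ _) (norm_mul_le _ _))
      _ ≤ (n * ‖u - v‖) * 1 + 1 * ‖u - v‖ := by gcongr
      _ = _ := by push_cast; ring

end PowerDifferences

/-! ### Exponentials in a Banach algebra -/

section Exponential

variable {A : Type*} [NormedRing A] [NormedAlgebra ℂ A] [CompleteSpace A]

theorem exp_smul_mul_exp_smul (X : A) (a b : ℂ) :
    NormedSpace.exp (a • X) * NormedSpace.exp (b • X) = NormedSpace.exp ((a + b) • X) := by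
  let : NormedAlgebra ℚ A := NormedAlgebra.restrictScalars ℚ ℂ A
  rw [add_smul, NormedSpace.exp_add_of_commute]
  exact ((Commute.refl X).smul_left a).smul_right b

theorem differentiable_exp_smul (X : A) :
    Differentiable ℂ fun z : ℂ => NormedSpace.exp (z • X) :=
  fun z => (hasDerivAt_exp_smul_const X z).differentiableAt

theorem hasDerivAt_exp_smul_zero (X : A) :
    HasDerivAt (fun z : ℂ => NormedSpace.exp (z • X)) X 0 := by
  simpa using hasDerivAt_exp_smul_const X (0 : ℂ)

theorem norm_exp_add_sub_exp_le [NormOneClass A] (x y : A) :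
    ‖NormedSpace.exp (x + y) - NormedSpace.exp x‖
      ≤ Real.exp (‖x‖ + ‖y‖) - Real.exp ‖x‖ := by
  have h := (NormedSpace.exp_series_hasSum_exp' (𝕂 := ℂ) (x + y)).sub
    (NormedSpace.exp_series_hasSum_exp' (𝕂 := ℂ) x)
  have h' := (NormedSpace.exp_series_hasSum_exp' (𝕂 := ℝ) (‖x‖ + ‖y‖)).sub
    (NormedSpace.exp_series_hasSum_exp' (𝕂 := ℝ) ‖x‖)
  rw [← Real.exp_eq_exp_ℝ] at h'
  rw [← h.tsum_eq]
  refine tsum_of_norm_bounded h' fun n => ?_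
  rw [← smul_sub, ← smul_sub, norm_smul, smul_eq_mul]
  have e : ‖((n.factorial : ℂ))⁻¹‖ = ((n.factorial : ℝ))⁻¹ := by simp
  rw [e]
  exact mul_le_mul_of_nonneg_left (norm_add_pow_sub_pow_le x y n) (by positivity)

theorem norm_exp_sub_one_le_exp_norm [NormOneClass A] (x : A) :
    ‖NormedSpace.exp x - 1‖ ≤ Real.exp ‖x‖ - 1 := by
  simpa using norm_exp_add_sub_exp_le 0 x

theorem norm_exp_le_real_exp [NormOneClass A] (x : A) :
    ‖NormedSpace.exp x‖ ≤ Real.exp ‖x‖ := by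
  have h := norm_exp_sub_one_le_exp_norm x
  have h' := norm_add_le (NormedSpace.exp x - 1) 1
  rw [sub_add_cancel, norm_one] at h'
  linarith

end Exponential

/-! ### Scalar majorants of products -/

section Majorant

variable {A : Type*} [NormedRing A]

/-- The pair `(U, U₀)` bounds `u₀` and the deviation of `u` from `u₀`, in the form that is
stable under products. -/
def MajorizedBy (u u₀ : A) (U U₀ : ℝ) : Prop :=
  ‖u₀‖ ≤ U₀ ∧ ‖u - u₀‖ ≤ U - U₀

theorem MajorizedBy.mul {u u₀ v v₀ : A} {U U₀ V V₀ : ℝ} (hu : MajorizedBy u u₀ U U₀)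
    (hv : MajorizedBy v v₀ V V₀) : MajorizedBy (u * v) (u₀ * v₀) (U * V) (U₀ * V₀) := by
  obtain ⟨hu0, hu1⟩ := hu
  obtain ⟨hv0, hv1⟩ := hv
  have hU0 : 0 ≤ U₀ := (norm_nonneg _).trans hu0
  have hv2 : ‖v‖ ≤ V := by
    have := norm_add_le (v - v₀) v₀
    rw [sub_add_cancel] at this
    linarith
  refine ⟨(norm_mul_le _ _).trans (mul_le_mul hu0 hv0 (norm_nonneg _) hU0), ?_⟩
  have e : u * v - u₀ * v₀ = (u - u₀) * v + u₀ * (v - v₀) := by noncomm_ring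
  rw [e]
  calc _ ≤ ‖u - u₀‖ * ‖v‖ + ‖u₀‖ * ‖v - v₀‖ :=
        (norm_add_le _ _).trans (add_le_add (norm_mul_le _ _) (norm_mul_le _ _))
    _ ≤ (U - U₀) * V + U₀ * (V - V₀) := by
      gcongr
      exact (norm_nonneg _).trans hu1
    _ = _ := by ring

end Majorant

/-! ### The splitting at complex time -/

section ComplexTime

variable {A : Type*} [NormedRing A] [NormedAlgebra ℂ A]

/-- Suzuki's splitting of `exp (z • (X + Y))` in a Banach algebra, at complex time `z`. -/
noncomputable def complexSuzuki (X Y : A) : ℕ → ℂ → A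
  | 0, _ => 1
  | 1, z => NormedSpace.exp ((z / 2) • X) * NormedSpace.exp (z • Y)
      * NormedSpace.exp ((z / 2) • X)
  | k + 2, z =>
      complexSuzuki X Y (k + 1) (suzukiP (k + 2) * z) ^ 2
        * complexSuzuki X Y (k + 1) ((1 - 4 * suzukiP (k + 2)) * z)
        * complexSuzuki X Y (k + 1) (suzukiP (k + 2) * z) ^ 2

variable [CompleteSpace A]

theorem complexSuzuki_mul_neg (X Y : A) (k : ℕ) (z : ℂ) :
    complexSuzuki X Y (k + 1) z * complexSuzuki X Y (k + 1) (-z) = 1 := by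
  induction k generalizing z with
  | zero =>
    have e : ∀ (W : A) (a : ℂ) (u : A),
        NormedSpace.exp (a • W) * (NormedSpace.exp ((-a) • W) * u) = u := fun W a u => by
      rw [← mul_assoc, exp_smul_mul_exp_smul]; simp
    have e' : ∀ (W : A) (a : ℂ),
        NormedSpace.exp (a • W) * NormedSpace.exp ((-a) • W) = 1 := fun W a => by
      rw [exp_smul_mul_exp_smul]; simp
    simp only [complexSuzuki, neg_div, mul_assoc, e, e']
  | succ k ih =>
    have e : ∀ w u, complexSuzuki X Y (k + 1) w * (complexSuzuki X Y (k + 1) (-w) * u) = u :=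
      fun w u => by rw [← mul_assoc, ih, one_mul]
    simp only [complexSuzuki, mul_neg, sq, mul_assoc, e, ih]

theorem complexSuzuki_agrees (X Y : A) (k : ℕ) :
    ∃ g, AgreesToOrder (fun z => NormedSpace.exp (z • (X + Y))) (2 * k + 3)
      (complexSuzuki X Y (k + 1)) 1 g := by
  have hE := differentiable_exp_smul (X + Y)
  have hE0 : NormedSpace.exp ((0 : ℂ) • (X + Y)) = 1 := by simp
  have hadd := exp_smul_mul_exp_smul (X + Y)
  induction k with
  | zero =>
    have hh : HasDerivAt (fun z : ℂ => NormedSpace.exp ((z / 2) • X)) ((1 / 2 : ℂ) • X) 0 := by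
      have h := hasDerivAt_exp_smul_zero ((1 / 2 : ℂ) • X)
      simpa only [smul_smul, mul_one_div] using h
    have hF := ((hh.mul (hasDerivAt_exp_smul_zero Y)).mul hh).sub
      (hasDerivAt_exp_smul_zero (X + Y))
    have hXd : Differentiable ℂ fun z : ℂ => NormedSpace.exp ((z / 2) • X) :=
      (differentiable_exp_smul X).comp (differentiable_id.div_const 2)
    have hd : Differentiable ℂ fun z => complexSuzuki X Y 1 z - NormedSpace.exp (z • (X + Y)) :=
      ((hXd.mul (differentiable_exp_smul Y)).mul hXd).sub hE
    have h1 : AgreesToOrder (fun z => NormedSpace.exp (z • (X + Y))) 1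
        (complexSuzuki X Y 1) 1 0 := by
      refine ⟨dslope (fun z => complexSuzuki X Y 1 z - NormedSpace.exp (z • (X + Y))) 0,
        ?_, ?_, fun z => ?_⟩
      · rw [← differentiableOn_univ] at hd ⊢
        exact (Complex.differentiableOn_dslope Filter.univ_mem).2 hd
      · rw [dslope_same]
        refine HasDerivAt.deriv ?_
        refine hF.congr_deriv ?_
        simp only [Pi.mul_apply, zero_div, zero_smul, NormedSpace.exp_zero, mul_one, one_mul]
        module
      · have h := sub_smul_dslope
          (fun z => complexSuzuki X Y 1 z - NormedSpace.exp (z • (X + Y))) 0 z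
        rw [sub_zero] at h
        rw [pow_one, h]
        simp [complexSuzuki]
    -- The first derivatives at `0` agree, which gives order `2`; symmetry then lifts the Strang
    -- splitting to order `3`.
    obtain ⟨g, h2⟩ := h1.succ
    have h3 := h2.eq_zero_of_symmetric hE hE0 hadd (by decide) (by decide)
      (complexSuzuki_mul_neg X Y 0)
    rw [h3] at h2
    exact h2.succ
  | succ k ih =>
    obtain ⟨g, h⟩ := ih
    refine h.suzuki_step hE hE0 hadd ⟨k + 1, by ring⟩ (p := (suzukiP (k + 2) : ℂ)) ?_
      (complexSuzuki_mul_neg X Y k)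
    have := suzukiP_root (k := k + 2) (by omega)
    rw [show 2 * (k + 2) - 1 = 2 * k + 3 by omega] at this
    exact_mod_cast this

/-- Only the `Y` factors deviate from the reference, where they become `1`. The reference factors
merge, since the signed times add up to `z`, while in the majorants the absolute times add up: `4p +
(4p - 1) = 8p - 1`. -/
theorem complexSuzuki_majorizedBy [NormOneClass A] (X Y : A) (k : ℕ) (z : ℂ) :
    MajorizedBy (complexSuzuki X Y (k + 1) z) (NormedSpace.exp (z • X))
      (Real.exp (suzukiTime (k + 1) * ‖z‖ * (‖X‖ + ‖Y‖)))
      (Real.exp (suzukiTime (k + 1) * ‖z‖ * ‖X‖)) := by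
  induction k generalizing z with
  | zero =>
    have hX : MajorizedBy (NormedSpace.exp ((z / 2) • X)) (NormedSpace.exp ((z / 2) • X))
        (Real.exp (‖z‖ / 2 * ‖X‖)) (Real.exp (‖z‖ / 2 * ‖X‖)) := by
      refine ⟨(norm_exp_le_real_exp _).trans_eq ?_, by simp⟩
      rw [norm_smul, norm_div, Complex.norm_two]
    have hY : MajorizedBy (NormedSpace.exp (z • Y)) 1 (Real.exp (‖z‖ * ‖Y‖)) 1 := by
      refine ⟨norm_one.le, (norm_exp_sub_one_le_exp_norm _).trans_eq ?_⟩
      rw [norm_smul]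
    have h := (hX.mul hY).mul hX
    rw [mul_one, mul_one, exp_smul_mul_exp_smul, add_halves, ← Real.exp_add, ← Real.exp_add,
      ← Real.exp_add] at h
    simp only [suzukiTime, complexSuzuki, one_mul]
    convert h using 2 <;> ring
  | succ k ih =>
    have hp := third_lt_suzukiP (k := k + 2) (by omega)
    set p := suzukiP (k + 2) with hpdef
    have n1 : ‖(p : ℂ) * z‖ = p * ‖z‖ := by
      rw [norm_mul, Complex.norm_real, Real.norm_of_nonneg (by linarith)]
    have n2 : ‖(1 - 4 * (p : ℂ)) * z‖ = (4 * p - 1) * ‖z‖ := by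
      have : (1 - 4 * (p : ℂ)) = ((1 - 4 * p : ℝ) : ℂ) := by push_cast; ring
      rw [norm_mul, this, Complex.norm_real, Real.norm_of_nonpos (by linarith)]
      ring
    have h1 := ih (p * z)
    have h2 := ih ((1 - 4 * p) * z)
    rw [n1] at h1
    rw [n2] at h2
    have h := ((h1.mul h1).mul h2).mul (h1.mul h1)
    simp only [exp_smul_mul_exp_smul, ← Real.exp_add] at h
    simp only [complexSuzuki, sq, suzukiTime, ← hpdef]
    convert h using 2 <;> ring_nf

/-- The local error of Suzuki's splitting, by the maximum principle on the disc of radius `R`. -/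
theorem norm_complexSuzuki_sub_exp_le [NormOneClass A] (X Y : A) (k : ℕ) {R : ℝ} (hR : 0 < R)
    {z : ℂ} (hz : ‖z‖ ≤ R) :
    ‖complexSuzuki X Y (k + 1) z - NormedSpace.exp (z • (X + Y))‖ ≤
      (‖z‖ / R) ^ (2 * k + 3) * (2 * (Real.exp (suzukiTime (k + 1) * R * (‖X‖ + ‖Y‖)) -
        Real.exp (suzukiTime (k + 1) * R * ‖X‖))) := by
  obtain ⟨g, G, hG, -, hS⟩ := complexSuzuki_agrees X Y k
  set c := suzukiTime (k + 1)
  have hc : 1 ≤ c := one_le_suzukiTime k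
  have hF : ∀ w, complexSuzuki X Y (k + 1) w - NormedSpace.exp (w • (X + Y))
      = w ^ (2 * k + 3) • G w := fun w => by rw [hS]; simp
  have hb : ∀ w : ℂ, ‖w‖ = R → ‖w ^ (2 * k + 3) • G w‖ ≤
      2 * (Real.exp (c * R * (‖X‖ + ‖Y‖)) - Real.exp (c * R * ‖X‖)) := by
    intro w hw
    have h1 := (complexSuzuki_majorizedBy X Y k w).2
    have h2 := norm_exp_add_sub_exp_le (w • X) (w • Y)
    rw [← smul_add, norm_smul, norm_smul, hw] at h2
    rw [hw] at h1
    -- The exact exponential obeys the same bound with `c = 1`, and the bound increases with `c`.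
    have h3 : Real.exp (R * ‖X‖ + R * ‖Y‖) - Real.exp (R * ‖X‖) ≤
        Real.exp (c * R * (‖X‖ + ‖Y‖)) - Real.exp (c * R * ‖X‖) := by
      have e : ∀ s : ℝ, Real.exp (s * R * ‖X‖ + s * R * ‖Y‖) - Real.exp (s * R * ‖X‖)
          = Real.exp (s * R * ‖X‖) * (Real.exp (s * R * ‖Y‖) - 1) := fun s => by
        rw [Real.exp_add]; ring
      have e1 := e 1
      have e2 := e c
      rw [one_mul] at e1
      rw [mul_add, e1, e2]
      have hX : R * ‖X‖ ≤ c * R * ‖X‖ := by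
        rw [mul_assoc]; exact le_mul_of_one_le_left (by positivity) hc
      have hY : R * ‖Y‖ ≤ c * R * ‖Y‖ := by
        rw [mul_assoc]; exact le_mul_of_one_le_left (by positivity) hc
      have h1 : 1 ≤ Real.exp (R * ‖Y‖) := Real.one_le_exp (by positivity)
      gcongr
    rw [← hF]
    have e : complexSuzuki X Y (k + 1) w - NormedSpace.exp (w • (X + Y)) =
        (complexSuzuki X Y (k + 1) w - NormedSpace.exp (w • X)) -
          (NormedSpace.exp (w • (X + Y)) - NormedSpace.exp (w • X)) := by abel
    rw [e]
    linarith [norm_sub_le (complexSuzuki X Y (k + 1) w - NormedSpace.exp (w • X))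
      (NormedSpace.exp (w • (X + Y)) - NormedSpace.exp (w • X))]
  have hGb : ‖G z‖ ≤ 2 * (Real.exp (c * R * (‖X‖ + ‖Y‖)) - Real.exp (c * R * ‖X‖))
      / R ^ (2 * k + 3) := by
    -- As in the Schwarz lemma, the power of `w` is divided out on the circle, where its norm is
    -- constant.
    refine Complex.norm_le_of_forall_mem_frontier_norm_le (U := Metric.ball 0 R)
      Metric.isBounded_ball hG.diffContOnCl (fun w hw => ?_) ?_
    · rw [frontier_ball _ hR.ne', mem_sphere_zero_iff_norm] at hw
      have h := hb w hw
      rw [norm_smul, norm_pow, hw] at h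
      rw [le_div_iff₀ (by positivity)]
      linarith
    · rw [closure_ball _ hR.ne', mem_closedBall_zero_iff]
      exact hz
  rw [hF, norm_smul, norm_pow, div_pow]
  calc _ ≤ ‖z‖ ^ (2 * k + 3) * (2 * (Real.exp (c * R * (‖X‖ + ‖Y‖)) - Real.exp (c * R * ‖X‖))
      / R ^ (2 * k + 3)) := by gcongr
    _ = _ := by ring

end ComplexTime

/-! ### Choice of the radius -/

section LocalError

variable {A : Type*} [NormedRing A] [NormedAlgebra ℂ A] [CompleteSpace A] [NormOneClass A]

theorem norm_complexSuzuki_sub_exp_le_pow {X Y : A} (hX : 0 < ‖X‖) (hYX : ‖Y‖ ≤ ‖X‖) (k : ℕ)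
    {z : ℂ} (hz : suzukiTime (k + 1) * ‖X‖ * ‖z‖ ≤ k + 1) :
    ‖complexSuzuki X Y (k + 1) z - NormedSpace.exp (z • (X + Y))‖ ≤
      2 * suzukiTime (k + 1) * ‖Y‖ * ‖z‖ *
        (Real.exp 1 * (suzukiTime (k + 1) * ‖X‖ * ‖z‖ / (k + 1))) ^ (2 * (k + 1)) := by
  have hc := one_le_suzukiTime k
  have hc0 : 0 < suzukiTime (k + 1) := by linarith
  set c := suzukiTime (k + 1)
  have hk : (0 : ℝ) < k + 1 := by positivity
  -- Then `c * R * ‖X‖ = k + 1`, and `‖Y‖ ≤ ‖X‖` keeps the exponent below `2 * (k + 1)`, so the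
  -- exponential becomes one factor `e` per power of `‖z‖ / R`, with one such power left to cancel
  -- `R`.
  set R : ℝ := (k + 1) / (c * ‖X‖) with hR
  have hR0 : 0 < R := by positivity
  have hzR : ‖z‖ ≤ R := by
    rw [hR, le_div_iff₀ (by positivity)]; linarith
  refine (norm_complexSuzuki_sub_exp_le X Y k hR0 hzR).trans ?_
  have hcRX : c * R * ‖X‖ = k + 1 := by rw [hR]; field_simp
  have hcRY : c * R * ‖Y‖ ≤ k + 1 := by rw [← hcRX]; gcongr
  have hexp : Real.exp (c * R * (‖X‖ + ‖Y‖)) - Real.exp (c * R * ‖X‖)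
      ≤ c * R * ‖Y‖ * Real.exp 1 ^ (2 * (k + 1)) := by
    have h1 : Real.exp (c * R * (‖X‖ + ‖Y‖)) - Real.exp (c * R * ‖X‖)
        ≤ c * R * ‖Y‖ * Real.exp (c * R * (‖X‖ + ‖Y‖)) := by
      have h := Real.add_one_le_exp (-(c * R * ‖Y‖))
      have e : Real.exp (c * R * ‖X‖)
          = Real.exp (c * R * (‖X‖ + ‖Y‖)) * Real.exp (-(c * R * ‖Y‖)) := by
        rw [← Real.exp_add]; ring_nf
      rw [e]
      nlinarith [Real.exp_pos (c * R * (‖X‖ + ‖Y‖))]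
    refine h1.trans ?_
    have h2 : c * R * (‖X‖ + ‖Y‖) ≤ ((2 * (k + 1) : ℕ) : ℝ) * 1 := by
      push_cast
      linarith
    rw [← Real.exp_nat_mul]
    gcongr
  have e1 : c * ‖X‖ * ‖z‖ / (k + 1) = ‖z‖ / R := by rw [hR]; field_simp
  change _ ≤ 2 * c * ‖Y‖ * ‖z‖ * (Real.exp 1 * (c * ‖X‖ * ‖z‖ / (k + 1))) ^ (2 * (k + 1))
  rw [e1, mul_pow]
  calc _ ≤ (‖z‖ / R) ^ (2 * k + 3) * (2 * (c * R * ‖Y‖ * Real.exp 1 ^ (2 * (k + 1)))) := by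
        gcongr
    _ = 2 * c * ‖Y‖ * ((‖z‖ / R) * R) *
        (Real.exp 1 ^ (2 * (k + 1)) * (‖z‖ / R) ^ (2 * (k + 1))) := by ring
    _ = _ := by rw [div_mul_cancel₀ _ hR0.ne']

end LocalError

/-! ### Real time: unitarity and counting exponentials -/

section Evolution

variable {E : Type*} [NormedAddCommGroup E] [InnerProductSpace ℂ E]

theorem evol_eq_exp_smul (H : E →L[ℂ] E) (s : ℝ) :
    evol H s = NormedSpace.exp ((s : ℂ) • (-Complex.I) • H) := by
  rw [evol, smul_smul, mul_neg, mul_comm]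

theorem suzukiS_eq_complexSuzuki (H₁ H₂ : E →L[ℂ] E) (k : ℕ) (s : ℝ) :
    suzukiS H₁ H₂ (k + 1) s
      = complexSuzuki ((-Complex.I) • H₁) ((-Complex.I) • H₂) (k + 1) s := by
  induction k generalizing s with
  | zero => simp [suzukiS, complexSuzuki, evol_eq_exp_smul]
  | succ k ih => simp [suzukiS, complexSuzuki, ih]

/-- The times and generators of the exponentials in `S_{2k}(s)`. -/
noncomputable def suzukiList : ℕ → ℝ → List (Bool × ℝ)
  | 0, _ => []
  | 1, s => [(false, s / 2), (true, s), (false, s / 2)]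
  | k + 2, s =>
      suzukiList (k + 1) (suzukiP (k + 2) * s) ++ suzukiList (k + 1) (suzukiP (k + 2) * s)
        ++ suzukiList (k + 1) ((1 - 4 * suzukiP (k + 2)) * s)
        ++ (suzukiList (k + 1) (suzukiP (k + 2) * s) ++ suzukiList (k + 1) (suzukiP (k + 2) * s))

theorem length_suzukiList (k : ℕ) (s : ℝ) : (suzukiList (k + 1) s).length = 3 * 5 ^ k := by
  induction k generalizing s with
  | zero => simp [suzukiList]
  | succ k ih => simp only [suzukiList, List.length_append, ih]; ring

theorem expProduct_append (H₁ H₂ : E →L[ℂ] E) (L L' : List (Bool × ℝ)) :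
    expProduct H₁ H₂ (L ++ L') = expProduct H₁ H₂ L * expProduct H₁ H₂ L' := by
  simp [expProduct]

theorem expProduct_suzukiList (H₁ H₂ : E →L[ℂ] E) (k : ℕ) (s : ℝ) :
    expProduct H₁ H₂ (suzukiList (k + 1) s) = suzukiS H₁ H₂ (k + 1) s := by
  induction k generalizing s with
  | zero => simp [suzukiList, suzukiS, expProduct, mul_assoc]
  | succ k ih => simp only [suzukiList, suzukiS, expProduct_append, ih, sq]

theorem expProduct_flatten_replicate (H₁ H₂ : E →L[ℂ] E) (L : List (Bool × ℝ)) (n : ℕ) :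
    expProduct H₁ H₂ (List.replicate n L).flatten = expProduct H₁ H₂ L ^ n := by
  induction n with
  | zero => simp [expProduct]
  | succ n ih => rw [List.replicate_succ, List.flatten_cons, expProduct_append, ih, pow_succ']

variable [CompleteSpace E]

theorem evol_mem_unitary {H : E →L[ℂ] E} (hH : IsSelfAdjoint H) (s : ℝ) :
    evol H s ∈ unitary (E →L[ℂ] E) := by
  let : NormedAlgebra ℚ (E →L[ℂ] E) := NormedAlgebra.restrictScalars ℚ ℂ _
  refine NormedSpace.exp_mem_unitary_of_mem_skewAdjoint (hH.smul_mem_skewAdjoint ?_)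
  rw [skewAdjoint.mem_iff]
  simp

theorem suzukiS_mem_unitary {H₁ H₂ : E →L[ℂ] E} (hH₁ : IsSelfAdjoint H₁)
    (hH₂ : IsSelfAdjoint H₂) (k : ℕ) (s : ℝ) :
    suzukiS H₁ H₂ (k + 1) s ∈ unitary (E →L[ℂ] E) := by
  induction k generalizing s with
  | zero =>
    exact mul_mem (mul_mem (evol_mem_unitary hH₁ _) (evol_mem_unitary hH₂ _))
      (evol_mem_unitary hH₁ _)
  | succ k ih => exact mul_mem (mul_mem (pow_mem (ih _) 2) (ih _)) (pow_mem (ih _) 2)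

theorem evol_div_pow (H : E →L[ℂ] E) (t : ℝ) {n : ℕ} (hn : 0 < n) :
    evol H (t / n) ^ n = evol H t := by
  let : NormedAlgebra ℚ (E →L[ℂ] E) := NormedAlgebra.restrictScalars ℚ ℂ _
  rw [evol_eq_exp_smul, evol_eq_exp_smul, ← NormedSpace.exp_nsmul, ← Nat.cast_smul_eq_nsmul ℂ,
    smul_smul]
  have : (n : ℂ) ≠ 0 := by exact_mod_cast hn.ne'
  congr 2
  push_cast
  field_simp

end Evolution

/-! ### Global error and number of steps -/

/-- Absorbs the prefactor `c` of the local error; `3/8` is what the constant `8e/3` in the step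
count leaves of `e`. -/
theorem suzukiTime_mul_pow_le_one (k : ℕ) : suzukiTime (k + 1) * (3 / 8) ^ (2 * (k + 1)) ≤ 1 := by
  have h1 : ((k : ℝ) + 1) ≤ 2 ^ k := by exact_mod_cast (Nat.lt_two_pow_self (n := k))
  calc _ ≤ ((k + 1) * (5 / 3) ^ k) * ((3 / 8 : ℝ) ^ (2 * (k + 1))) := by
        gcongr; exact suzukiTime_le k
    _ ≤ (2 ^ k * (5 / 3) ^ k) * ((3 / 8 : ℝ) ^ (2 * (k + 1))) := by gcongr
    _ = (15 / 32) ^ k * (9 / 64) := by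
        rw [pow_mul, pow_succ, ← mul_pow, ← mul_assoc, ← mul_pow]; norm_num
    _ ≤ 1 * 1 := by
        gcongr
        · exact pow_le_one₀ (by norm_num) (by norm_num)
        · norm_num
    _ = 1 := one_mul 1

theorem theorem1 {E : Type*} [NormedAddCommGroup E] [InnerProductSpace ℂ E] [CompleteSpace E]
    (H₁ H₂ : E →L[ℂ] E) (hH₁ : IsSelfAdjoint H₁) (hH₂ : IsSelfAdjoint H₂)
    (hle : ‖H₂‖ ≤ ‖H₁‖) (t ε : ℝ) (hε : 0 < ε) (hε1 : ε ≤ 1)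
    (ht : ε ≤ 8 * Real.exp 1 * t * ‖H₂‖) (k : ℕ) (hk : 1 ≤ k) :
    ∃ (n : ℕ) (L : List (Bool × ℝ)), 0 < n ∧
      expProduct H₁ H₂ L = suzukiS H₁ H₂ k (t / n) ^ n ∧
      ‖evol (H₁ + H₂) t - expProduct H₁ H₂ L‖ ≤ ε ∧
      (L.length : ℤ) ≤ 3 * 5 ^ (k - 1) *
        ⌈‖H₁‖ * t * (8 * Real.exp 1 * t * ‖H₂‖ / ε) ^ (1 / (2 * (k : ℝ)))
          * (8 * Real.exp 1 / 3) * (5 / 3 : ℝ) ^ (k - 1)⌉ := by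
  obtain ⟨j, rfl⟩ : ∃ j, k = j + 1 := ⟨k - 1, by omega⟩
  rw [Nat.add_sub_cancel]
  have he : 1 ≤ Real.exp 1 := Real.one_le_exp zero_le_one
  have hprod : 0 < 8 * Real.exp 1 * t * ‖H₂‖ := hε.trans_le ht
  have hβ : 0 < ‖H₂‖ := (norm_nonneg _).lt_of_ne' fun h => by simp [h] at hprod
  have ht0 : 0 < t := by
    have := pos_of_mul_pos_left hprod hβ.le
    exact pos_of_mul_pos_right this (by positivity)
  have hα : 0 < ‖H₁‖ := hβ.trans_le hle
  -- On the zero space `‖1‖ = 0`; the lower bound `ht` excludes it.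
  have : Nontrivial (E →L[ℂ] E) := ⟨H₁, 0, norm_pos_iff.1 hα⟩
  have : NormOneClass (E →L[ℂ] E) := ⟨CStarRing.norm_one⟩
  set B := 8 * Real.exp 1 * t * ‖H₂‖ / ε with hB
  have hB1 : 1 ≤ B := (one_le_div hε).2 ht
  have hB0 : 0 < B := by linarith
  set b := B ^ (1 / (2 * ((j + 1 : ℕ) : ℝ))) with hb
  have hb0 : 0 < b := Real.rpow_pos_of_pos hB0 _
  have hb1 : 1 ≤ b := Real.one_le_rpow hB1 (by positivity)
  have hbB : b ^ (2 * (j + 1)) = B := by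
    rw [hb, ← Real.rpow_natCast, ← Real.rpow_mul hB0.le]
    have : 1 / (2 * ((j + 1 : ℕ) : ℝ)) * ((2 * (j + 1) : ℕ) : ℝ) = 1 := by
      push_cast; field_simp
    rw [this, Real.rpow_one]
  set D := ‖H₁‖ * t * b * (8 * Real.exp 1 / 3) * (5 / 3 : ℝ) ^ j with hD
  have hD0 : 0 < D := by positivity
  have hn0 : 0 < ⌈D⌉₊ := Nat.ceil_pos.2 hD0
  refine ⟨⌈D⌉₊, (List.replicate ⌈D⌉₊ (suzukiList (j + 1) (t / ⌈D⌉₊))).flatten, hn0,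
    by rw [expProduct_flatten_replicate, expProduct_suzukiList], ?_, ?_⟩
  · rw [expProduct_flatten_replicate, expProduct_suzukiList]
    have hDn : D ≤ ⌈D⌉₊ := Nat.le_ceil D
    set n := ⌈D⌉₊
    have hnR : (0 : ℝ) < n := by exact_mod_cast hn0
    rw [← evol_div_pow _ t hn0]
    set h := t / (n : ℝ) with hh
    have hh0 : 0 < h := by positivity
    refine (norm_pow_sub_pow_le_mul
      (CStarRing.norm_of_mem_unitary (evol_mem_unitary (hH₁.add hH₂) h)).le
      (CStarRing.norm_of_mem_unitary (suzukiS_mem_unitary hH₁ hH₂ j h)).le n).trans ?_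
    have hc := one_le_suzukiTime j
    -- `D` is made for this: the factor `j + 1` in `suzukiTime_le` cancels the one from the radius,
    -- and `(5/3) ^ j` the one in `D`. The power `2 * (j + 1)` of `1 / b` is then `1 / B`, which
    -- supplies `ε`.
    have hratio : suzukiTime (j + 1) * ‖H₁‖ * h / (j + 1) ≤ 3 / (8 * Real.exp 1 * b) := by
      rw [div_le_div_iff₀ (by positivity) (by positivity)]
      have h1 : D * h ≤ t := by
        rw [hh, mul_div_assoc', div_le_iff₀ hnR, mul_comm t]; gcongr
      have h2 : ‖H₁‖ * b * (8 * Real.exp 1 / 3) * (5 / 3 : ℝ) ^ j * h ≤ 1 := by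
        have : t * (‖H₁‖ * b * (8 * Real.exp 1 / 3) * (5 / 3 : ℝ) ^ j * h) ≤ t * 1 := by
          rw [mul_one]
          refine le_trans (le_of_eq ?_) h1
          rw [hD]; ring
        exact le_of_mul_le_mul_left this ht0
      calc _ ≤ ((j + 1) * (5 / 3) ^ j) * ‖H₁‖ * h * (8 * Real.exp 1 * b) := by
            gcongr; exact suzukiTime_le j
        _ = 3 * (j + 1) *
            (‖H₁‖ * b * (8 * Real.exp 1 / 3) * (5 / 3 : ℝ) ^ j * h) := by ring
        _ ≤ 3 * (j + 1) * 1 := by gcongr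
        _ = _ := by ring
    have hsmall : suzukiTime (j + 1) * ‖H₁‖ * h ≤ j + 1 := by
      have : 3 / (8 * Real.exp 1 * b) ≤ 1 := by
        rw [div_le_one (by positivity)]
        have := one_le_mul_of_one_le_of_one_le he hb1
        linarith
      exact (div_le_one (by positivity)).1 (hratio.trans this)
    have nI : ∀ H : E →L[ℂ] E, ‖(-Complex.I) • H‖ = ‖H‖ := fun H => by simp [norm_smul]
    have nh : ‖(h : ℂ)‖ = h := by rw [Complex.norm_real, Real.norm_of_nonneg hh0.le]
    have key := norm_complexSuzuki_sub_exp_le_pow (X := (-Complex.I) • H₁)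
      (Y := (-Complex.I) • H₂) (by rwa [nI]) (by rwa [nI, nI]) j (z := h) (by rwa [nI, nh])
    rw [nI, nI, nh, ← suzukiS_eq_complexSuzuki, ← smul_add, ← evol_eq_exp_smul,
      norm_sub_rev] at key
    calc (n : ℝ) * ‖evol (H₁ + H₂) h - suzukiS H₁ H₂ (j + 1) h‖
        ≤ n * (2 * suzukiTime (j + 1) * ‖H₂‖ * h *
          (Real.exp 1 * (3 / (8 * Real.exp 1 * b))) ^ (2 * (j + 1))) := by
          refine mul_le_mul_of_nonneg_left (key.trans ?_) hnR.le
          gcongr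
      _ = 2 * ‖H₂‖ * t / B * (suzukiTime (j + 1) * (3 / 8) ^ (2 * (j + 1))) := by
          have e : Real.exp 1 * (3 / (8 * Real.exp 1 * b)) = 3 / 8 / b := by field_simp
          rw [e, div_pow _ b, hbB, hh]
          field_simp
      _ ≤ 2 * ‖H₂‖ * t / B * 1 := by
          gcongr; exact suzukiTime_mul_pow_le_one j
      _ = ε / (4 * Real.exp 1) := by
          rw [hB]; field_simp; norm_num
      _ ≤ ε := div_le_self hε.le (by linarith)
  · rw [List.length_flatten, List.map_replicate, List.sum_replicate, length_suzukiList,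
      smul_eq_mul]
    have : ((⌈D⌉₊ : ℕ) : ℤ) = ⌈D⌉ := Int.natCast_ceil_eq_ceil hD0.le
    rw [← this]
    push_cast
    exact (mul_comm _ _).le
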